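/- Call $C\subseteq\mathbb Z$ a MAC if there is $W\subseteq\mathbb Z$ such that $C+W=\mathbb Z$ and $C'+W\ne\mathbb Z$ for every proper subset $C'\subsetneq C$. For $m\in\mathbb N=\{0,1,2,\dots\}$ let $\pi_m\colon\mathbb Z^2\to\mathbb Z$, $\pi_m(x,y)=x+my$, and for $\hat S\subseteq\mathbb Z^2$ let $\hat S_/$ be the set of $x$-coordinates of the points of $\hat S$. Let $\hat A,\hat B,\hat F\subseteq\mathbb Z^2$ be fixed finite sets (patterns) with $\hat F\neq\emptyset$, $\hat B_/\subseteq\hat A_/$ and $\hat F_/\cap\hat A_/=\emptyset$. For each $m$ put $A=\pi_m(\hat A)$, $B=\pi_m(\hat B)$, $F=\pi_m(\hat F)$ and $$C=(m\mathbb N+A)\cup B\cup F,$$ so that $C=\pi_m(\hat C)$ with $\hat C=\{(x,y):(x,y_0)\in\hat A\text{ for some }y_0\le y\}\cup\hat B\cup\hat F$. Then $C$ is a MAC for all sufficiently large $m$. Explicitly, $C$ is a MAC for every $m$ with $$m\ge(\ell+1)\bigl(|A|+|B|+|\hat F_/|\bigr),$$ where $\ell$ is the least number of elements of a nonempty interval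 $[a,b]$ of integers for which there is $W\subseteq\mathbb Z$ with $\hat C_/+W=[a,b]$. Moreover, let $\hat C_/=I_1\cup\dots\cup I_k$ be the decomposition into maximal blocks of consecutive integers, ordered from left to right, and put $\mathrm{outerrange}(\hat C_/)=\max I_k-\min I_1$ and $\mathrm{innerrange}(\hat C_/)=\min I_k-\max I_1$. If $k\ge2$, then $$\ell\le\mathrm{outerrange}(\hat C_/)+\mathrm{innerrange}(\hat C_/),$$ and if $k=1$, then $\ell=\mathrm{outerrange}(\hat C_/)+1$. -/

import Mathlib

open scoped Pointwise

/-- `C` is an additive complement to `W` in the abelian group `G`: the Minkowski sum is `G`. -/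
def IsAddComplement {G : Type*} [AddCommGroup G] (C W : Set G) : Prop :=
  C + W = Set.univ

/-- `C` is a minimal additive complement (MAC) to `W`. -/
def IsMACTo {G : Type*} [AddCommGroup G] (C W : Set G) : Prop :=
  IsAddComplement C W ∧ ∀ C' : Set G, C' ⊂ C → ¬ IsAddComplement C' W

/-- `C` arises as a MAC. -/
def IsMAC {G : Type*} [AddCommGroup G] (C : Set G) : Prop :=
  ∃ W : Set G, IsMACTo C W

/-- The projection `π_m : ℤ² → ℤ²/ℤ(m,-1) ≅ ℤ`, `(x, y) ↦ x + m y`. -/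
def latticeProj (m : ℕ) (p : ℤ × ℤ) : ℤ := p.1 + (m : ℤ) * p.2

/-- `S_/`: the set of `x`-coordinates of a set of lattice points. -/
def xCoords (S : Set (ℤ × ℤ)) : Set ℤ := Prod.fst '' S

/-- `(mℕ + A) ∪ B ∪ F`, where `0 ∈ ℕ`. -/
def evPeriodicSet (m : ℕ) (A B F : Set ℤ) : Set ℤ :=
  (Set.range (fun n : ℕ => (m : ℤ) * (n : ℤ)) + A) ∪ B ∪ F

/-- The set of lattice points lying on the upward vertical rays that start at the points of `S`. -/
def upRays (S : Set (ℤ × ℤ)) : Set (ℤ × ℤ) := {p | ∃ a ∈ S, p.1 = a.1 ∧ a.2 ≤ p.2}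

/-- The pattern `Ĉ ⊆ ℤ²` assembled from the patterns `Â`, `B̂`, `F̂`. -/
def fullPattern (A B F : Set (ℤ × ℤ)) : Set (ℤ × ℤ) := upRays A ∪ B ∪ F

/-- The full pattern projects onto the eventually periodic set. -/
theorem latticeProj_image_fullPattern (m : ℕ) (A B F : Set (ℤ × ℤ)) :
    latticeProj m '' fullPattern A B F =
      evPeriodicSet m (latticeProj m '' A) (latticeProj m '' B) (latticeProj m '' F) := by
  have h : latticeProj m '' upRays A =
      Set.range (fun n : ℕ => (m : ℤ) * (n : ℤ)) + latticeProj m '' A := by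
    ext z
    constructor
    · rintro ⟨p, ⟨a, ha, h1, h2⟩, rfl⟩
      obtain ⟨n, hn⟩ := Int.eq_ofNat_of_zero_le (sub_nonneg.2 h2)
      refine Set.mem_add.2 ⟨_, ⟨n, rfl⟩, _, ⟨a, ha, rfl⟩, ?_⟩
      simp only [latticeProj, ← hn, h1]
      ring
    · intro hz
      obtain ⟨_, ⟨n, rfl⟩, _, ⟨a, ha, rfl⟩, rfl⟩ := Set.mem_add.1 hz
      refine ⟨(a.1, a.2 + n), ⟨a, ha, rfl, by simp⟩, ?_⟩
      simp only [latticeProj]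
      ring
  simp only [fullPattern, evPeriodicSet, Set.image_union, h]

/-- `n` is the length (number of elements) of some nonempty interval `[a, b]` of integers that is
a union of translates of `S`. -/
def IsBlockLength (S : Set ℤ) (n : ℕ) : Prop :=
  ∃ (a b : ℤ) (W : Set ℤ), a ≤ b ∧ S + W = Set.Icc a b ∧ (n : ℤ) = b - a + 1

/-- `ℓ`: the minimal length of a block of consecutive integers formed by translates of `S`. -/
noncomputable def minBlockLength (S : Set ℤ) : ℕ := sInf {n | IsBlockLength S n}

/-- The minimum defining `minBlockLength` is attained for finite nonempty sets. -/
theorem isLeast_minBlockLength (S : Set ℤ) (hS : S.Finite) (hne : S.Nonempty) :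
    IsLeast {n | IsBlockLength S n} (minBlockLength S) := by
  have hex : ({n | IsBlockLength S n} : Set ℕ).Nonempty := by
    obtain ⟨u, hu, hmin⟩ := Set.exists_min_image S id hS hne
    obtain ⟨v, hv, hmax⟩ := Set.exists_max_image S id hS hne
    simp only [id] at hmin hmax
    have huv := hmin v hv
    refine ⟨(v + (v - u) - u + 1).toNat, u, v + (v - u), Set.Icc 0 (v - u), by omega, ?_,
      by omega⟩
    ext z
    simp only [Set.mem_add, Set.mem_Icc]
    constructor
    · rintro ⟨s, hs, w, hw, rfl⟩
      have h1 := hmin s hs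
      have h2 := hmax s hs
      omega
    · intro hz
      by_cases h : z ≤ v
      · exact ⟨u, hu, z - u, by omega, by omega⟩
      · exact ⟨v, hv, z - v, by omega, by omega⟩
  exact ⟨Nat.sInf_mem hex, fun n hn => Nat.sInf_le hn⟩

/-- The distance from the minimum to the maximum of `S`. -/
noncomputable def outerrange (S : Set ℤ) : ℤ := sSup S - sInf S

/-- The distance from the end of the first maximal block of consecutive integers in `S` to the
beginning of the last one. -/
noncomputable def innerrange (S : Set ℤ) : ℤ :=
  sSup {s | s ∈ S ∧ s - 1 ∉ S} - sInf {s | s ∈ S ∧ s + 1 ∉ S}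

/-! Each residue class u + mℤ is a copy of ℤ on which the heights of the pattern act. So W can be
prescribed separately on a few special classes, one for each column of `A`, point of `B` and column
of `F`, making every pattern point indispensable in one of them. All other integers are covered by
translates that avoid the special classes: spacing these ℓ + 1 apart leaves gaps of at least ℓ free
residues, where a block built from translates of the columns fits (`isMAC_latticeProj_image`).

Nonemptiness of `F` is what makes the prescriptions possible: a column of `F` is bounded, so its
translates can fill all remaining heights without touching the protected ones. A column of `F`
itself is a finite set, treated by `isMAC_of_finite`. -/

/-! ### Finite sets of integers -/

/-- Every nonempty finite set of integers arises as a MAC. -/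
theorem isMAC_of_finite (S : Set ℤ) (hS : S.Finite) (hne : S.Nonempty) : IsMAC S := by
  obtain ⟨u, hu, hmin⟩ := Set.exists_min_image S id hS hne
  obtain ⟨v, hv, hmax⟩ := Set.exists_max_image S id hS hne
  simp only [id] at hmin hmax
  have huv := hmin v hv
  obtain ⟨D, hD⟩ : ∃ D : ℤ, D = v - u + 1 := ⟨_, rfl⟩
  have hDpos : 0 < D := by omega
  -- The witnesses `4 * D * c`, `c ∈ S`, are far apart compared with the diameter of `S`.
  have hsep : ∀ c c' : ℤ, |4 * D * c - 4 * D * c'| < 4 * D → c = c' := by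
    intro c c' h
    rw [← mul_sub, abs_mul, abs_of_pos (by positivity : 0 < 4 * D)] at h
    have h1 : |c - c'| < 1 := by
      by_contra hc
      nlinarith
    have := Int.abs_lt_one_iff.1 h1
    omega
  -- Only those translates are removed by which some d ≠ c would reach the witness of c.
  refine ⟨{w | ∀ c ∈ S, ∀ d ∈ S, d ≠ c → w ≠ 4 * D * c - d}, ?_, ?_⟩
  · refine Set.eq_univ_of_forall fun z => ?_
    by_contra hz
    have hall : ∀ s ∈ S, ∃ c ∈ S, ∃ d ∈ S, d ≠ c ∧ z - s = 4 * D * c - d := by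
      intro s hs
      by_contra hcon
      push Not at hcon
      exact hz (Set.mem_add.2 ⟨s, hs, z - s, fun c hc d hd hdc => hcon c hc d hd hdc, by omega⟩)
    obtain ⟨c, hc, d, hd, hdc, hzd⟩ := hall u hu
    have hsame : ∀ s ∈ S, ∃ d' ∈ S, d' ≠ c ∧ z - s = 4 * D * c - d' := by
      intro s hs
      obtain ⟨c', hc', d', hd', hdc', hzd'⟩ := hall s hs
      have hcc : c = c' := by
        apply hsep
        have := hmin s hs; have := hmax s hs; have := hmin d hd
        have := hmax d hd; have := hmin d' hd'; have := hmax d' hd'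
        rw [abs_lt]
        constructor <;> omega
      subst hcc
      exact ⟨d', hd', hdc', hzd'⟩
    -- The translate of `S` by `4 * D * c - z` lies in `S`, so it is trivial.
    obtain ⟨d₁, hd₁, -, h₁⟩ := hsame u hu
    obtain ⟨d₂, hd₂, -, h₂⟩ := hsame v hv
    have := hmin d₁ hd₁
    have := hmax d₂ hd₂
    obtain ⟨d₃, hd₃, h₃, h₄⟩ := hsame c hc
    omega
  · intro S' hS' hcov
    obtain ⟨c, hc, hcS'⟩ := Set.exists_of_ssubset hS'
    have hz : 4 * D * c ∈ S' + {w | ∀ c ∈ S, ∀ d ∈ S, d ≠ c → w ≠ 4 * D * c - d} := by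
      rw [show S' + _ = Set.univ from hcov]
      trivial
    obtain ⟨d, hd, w, hw, hdw⟩ := Set.mem_add.1 hz
    exact hw c hc d (hS'.1 hd) (fun h => hcS' (h ▸ hd)) (by omega)

/-! ### Gluing complements of residue classes -/

/-- Local criterion for the projection of a pattern to be a MAC: it suffices to have well separated
residue classes `u i + m ℤ`, each with a complement `Y i s` inside the classes `u i - s + m ℤ`, such
that each point of the pattern is indispensable for some class. -/
theorem isMAC_latticeProj_image {ι : Type*} (m : ℕ) (P : Set (ℤ × ℤ)) (a b : ℤ) (V : Set ℤ)
    (hV : xCoords P + V = Set.Icc a b) (hab : a ≤ b) (u : ι → ℤ)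
    (hu : ∀ i j (n : ℤ), |u i - u j + m * n| ≤ b - a + 1 → i = j ∧ n = 0)
    (Y : ι → ℤ → Set ℤ) (hcov : ∀ i t, ∃ p ∈ P, t - p.2 ∈ Y i p.1)
    (hmin : ∀ p ∈ P, ∃ i t, t - p.2 ∈ Y i p.1 ∧ ∀ q ∈ P, t - q.2 ∈ Y i q.1 → q = p) :
    IsMAC (latticeProj m '' P) := by
  have hVmem : ∀ s ∈ xCoords P, ∀ v ∈ V, a ≤ s + v ∧ s + v ≤ b := by
    intro s hs v hv
    have h : s + v ∈ xCoords P + V := Set.add_mem_add hs hv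
    rwa [hV] at h
  obtain ⟨v₀, hv₀⟩ : V.Nonempty := by
    have h : a ∈ xCoords P + V := by rw [hV]; exact ⟨le_rfl, hab⟩
    obtain ⟨_, _, v, hv, _⟩ := Set.mem_add.1 h
    exact ⟨v, hv⟩
  -- Translates missing every special class, together with the prescribed ones.
  obtain ⟨W, hW⟩ : ∃ W : Set ℤ, W = {w | ∀ s ∈ xCoords P, ∀ i (n : ℤ), w + s ≠ u i + m * n} ∪
      {w | ∃ i, ∃ s ∈ xCoords P, ∃ y ∈ Y i s, w = u i - s + m * y} := ⟨_, rfl⟩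
  -- Two columns differ by at most b - a, so by separation a translate prescribed for one class and
  -- column cannot meet a special class through another column.
  have key : ∀ p ∈ P, ∀ w ∈ W, ∀ i t, latticeProj m p + w = u i + m * t →
      t - p.2 ∈ Y i p.1 := by
    intro p hp w hw i t h
    simp only [latticeProj] at h
    rw [hW] at hw
    rcases hw with hw | ⟨j, s, hs, y, hy, rfl⟩
    · exact absurd (by linarith) (hw p.1 ⟨p, hp, rfl⟩ i (t - p.2))
    · have heq : u i - u j + m * (t - p.2 - y) = p.1 - s := by linarith
      have h1 := hVmem s hs v₀ hv₀
      have h2 := hVmem p.1 ⟨p, hp, rfl⟩ v₀ hv₀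
      obtain ⟨rfl, h0⟩ := hu i j (t - p.2 - y) (by rw [heq, abs_le]; constructor <;> omega)
      rw [h0] at heq
      obtain rfl : p.1 = s := by linarith
      obtain rfl : t - p.2 = y := by linarith
      exact hy
  refine ⟨W, Set.eq_univ_of_forall fun z => ?_, ?_⟩
  · by_cases hz : ∃ i, ∃ n : ℤ, z = u i + m * n
    · obtain ⟨i, t, rfl⟩ := hz
      obtain ⟨p, hp, hy⟩ := hcov i t
      refine Set.mem_add.2 ⟨_, ⟨p, hp, rfl⟩, u i - p.1 + m * (t - p.2), ?_, ?_⟩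
      · rw [hW]
        exact Or.inr ⟨i, p.1, ⟨p, hp, rfl⟩, _, hy, rfl⟩
      · simp only [latticeProj]
        ring
    · -- A window of length `b - a + 1` around `z` free of special residues.
      obtain ⟨g, hg1, hg2, hg⟩ : ∃ g, g ≤ z ∧ z ≤ g + (b - a) ∧
          ∀ x, g ≤ x → x ≤ g + (b - a) → ∀ i (n : ℤ), x ≠ u i + m * n := by
        by_cases hw : ∀ x, z ≤ x → x ≤ z + (b - a) → ∀ i (n : ℤ), x ≠ u i + m * n
        · exact ⟨z, le_rfl, by omega, hw⟩
        · push Not at hw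
          obtain ⟨x, hx1, hx2, i, n, hx⟩ := hw
          have hxz : x ≠ z := fun h => hz ⟨i, n, h ▸ hx⟩
          -- The window ending just before the special element x still contains z, and by separation
          -- it contains no other special element.
          refine ⟨x - (b - a + 1), by omega, by omega, fun x' h1 h2 j n' hx' => ?_⟩
          have heq : u i - u j + m * (n - n') = x - x' := by rw [hx, hx']; ring
          obtain ⟨rfl, h0⟩ := hu i j (n - n') (by rw [heq, abs_le]; constructor <;> omega)
          rw [h0] at heq
          omega
      have hmem : z - g + a ∈ xCoords P + V := by rw [hV]; constructor <;> omega
      obtain ⟨s, ⟨p, hp, rfl⟩, v, hv, hsv⟩ := Set.mem_add.1 hmem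
      -- The block [a, b] is shifted onto the window; subtracting m * p.2 cancels the height of p
      -- and preserves residues.
      refine Set.mem_add.2 ⟨_, ⟨p, hp, rfl⟩, v + g - a - m * p.2, ?_, ?_⟩
      · rw [hW]
        refine Or.inl fun s hs i n h => ?_
        have := hVmem s hs v hv
        exact hg (v + g - a + s) (by omega) (by omega) i (n + p.2) (by linarith)
      · simp only [latticeProj]
        linarith
  · intro C' hC' hcov'
    obtain ⟨c, ⟨p, hp, rfl⟩, hcC'⟩ := Set.exists_of_ssubset hC'
    obtain ⟨i, t, -, huniq⟩ := hmin p hp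
    have hz : u i + m * t ∈ C' + W := by
      rw [show C' + W = Set.univ from hcov']
      trivial
    obtain ⟨d, hd, w, hw, hdw⟩ := Set.mem_add.1 hz
    obtain ⟨q, hq, rfl⟩ := hC'.1 hd
    exact hcC' (huniq q hq (key q hq w hw i t hdw) ▸ hd)

/-- The multiples lie in [0, L(k - 1)], so m ≥ Lk keeps a distance of at least L also across the
wraparound modulo m. -/
theorem multiples_separated (L k m x y n : ℤ) (hL : 0 < L) (hk : L * k ≤ m) (hx0 : 0 ≤ x)
    (hx : x < k) (hy0 : 0 ≤ y) (hy : y < k) (h : |L * x - L * y + m * n| < L) :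
    x = y ∧ n = 0 := by
  rw [abs_lt] at h
  have hLk : L * 1 ≤ L * k := mul_le_mul_of_nonneg_left (by omega) hL.le
  have h1 : L * (x - y) ≤ L * (k - 1) := mul_le_mul_of_nonneg_left (by omega) hL.le
  have h2 : L * (y - x) ≤ L * (k - 1) := mul_le_mul_of_nonneg_left (by omega) hL.le
  have hn : n = 0 := by
    rcases lt_trichotomy n 0 with hn | hn | hn
    · have : m * n ≤ m * (-1) := mul_le_mul_of_nonneg_left (by omega) (by linarith)
      linarith
    · exact hn
    · have : m * 1 ≤ m * n := mul_le_mul_of_nonneg_left (by omega) (by linarith)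
      linarith
  subst hn
  refine ⟨?_, rfl⟩
  rcases lt_trichotomy x y with hxy | hxy | hxy
  · have : L * 1 ≤ L * (y - x) := mul_le_mul_of_nonneg_left (by omega) hL.le
    linarith
  · exact hxy
  · have : L * 1 ≤ L * (x - y) := mul_le_mul_of_nonneg_left (by omega) hL.le
    linarith

/-- The local criterion with the residue classes `(n + 1) i`, where `n` is a block length. -/
theorem isMAC_latticeProj_image_of_card {ι : Type*} [Finite ι] (m n : ℕ) (P : Set (ℤ × ℤ))
    (hn : IsBlockLength (xCoords P) n) (hm : (n + 1) * Nat.card ι ≤ m)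
    (Y : ι → ℤ → Set ℤ) (hcov : ∀ i t, ∃ p ∈ P, t - p.2 ∈ Y i p.1)
    (hmin : ∀ p ∈ P, ∃ i t, t - p.2 ∈ Y i p.1 ∧ ∀ q ∈ P, t - q.2 ∈ Y i q.1 → q = p) :
    IsMAC (latticeProj m '' P) := by
  obtain ⟨a, b, V, hab, hV, hnab⟩ := hn
  let e := Finite.equivFin ι
  refine isMAC_latticeProj_image m P a b V hV hab (fun i => ((n : ℤ) + 1) * (e i : ℕ)) ?_ Y
    hcov hmin
  intro i j k h
  have hi := (e i).2
  have hj := (e j).2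
  obtain ⟨h1, h2⟩ := multiples_separated ((n : ℤ) + 1) (Nat.card ι) m (e i : ℕ) (e j : ℕ) k
    (by omega) (by exact_mod_cast hm) (by omega) (by omega) (by omega) (by omega) (by omega)
  exact ⟨e.injective (Fin.ext (by exact_mod_cast h1)), h2⟩

/-! ### Complements within one residue class -/

/-- The points of a pattern with `x`-coordinate `x`. -/
def fiberAt (S : Set (ℤ × ℤ)) (x : ℤ) : Set ℤ := {y | (x, y) ∈ S}

theorem fiberAt_finite {S : Set (ℤ × ℤ)} (hS : S.Finite) (x : ℤ) : (fiberAt S x).Finite :=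
  hS.preimage (f := Prod.mk x) (fun _ _ _ _ h => (Prod.mk.inj h).2)

theorem fiberAt_nonempty {S : Set (ℤ × ℤ)} {x : ℤ} (hx : x ∈ xCoords S) :
    (fiberAt S x).Nonempty := by
  obtain ⟨p, hp, rfl⟩ := hx
  exact ⟨p.2, hp⟩

theorem xCoords_upRays (A : Set (ℤ × ℤ)) : xCoords (upRays A) = xCoords A := by
  ext x
  constructor
  · rintro ⟨p, ⟨a, ha, h1, -⟩, rfl⟩
    exact ⟨a, ha, h1.symm⟩
  · rintro ⟨a, ha, rfl⟩
    exact ⟨a, ⟨a, ha, rfl, le_rfl⟩, rfl⟩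

theorem xCoords_fullPattern (A B F : Set (ℤ × ℤ)) :
    xCoords (fullPattern A B F) = xCoords A ∪ xCoords B ∪ xCoords F := by
  rw [← xCoords_upRays A]
  simp only [xCoords, fullPattern, Set.image_union]

/-- In the columns of `F` the full pattern coincides with `F`. -/
theorem mem_F_of_fullPattern {A B F : Set (ℤ × ℤ)} (hBA : xCoords B ⊆ xCoords A)
    (hFA : Disjoint (xCoords F) (xCoords A)) {p : ℤ × ℤ} (hp : p ∈ fullPattern A B F)
    (hx : p.1 ∈ xCoords F) : p ∈ F := by
  rcases hp with (⟨a, ha, h1, -⟩ | hp) | hp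
  · exact absurd ⟨a, ha, h1.symm⟩ (Set.disjoint_left.1 hFA hx)
  · exact absurd (hBA ⟨p, hp, rfl⟩) (Set.disjoint_left.1 hFA hx)
  · exact hp

section LocalComplements

variable {A B F : Set (ℤ × ℤ)}

/-- Near a column of `A`, a single translate makes all points of the ray indispensable, the rest of
the column being filled from a column of `F`. -/
theorem exists_local_complement_ray (hA : A.Finite) (hF : F.Finite) (hFne : F.Nonempty)
    (hBA : xCoords B ⊆ xCoords A) (hFA : Disjoint (xCoords F) (xCoords A))
    (x : ℤ) (hx : x ∈ xCoords A) :
    ∃ Y : ℤ → Set ℤ, (∀ t, ∃ p ∈ fullPattern A B F, t - p.2 ∈ Y p.1) ∧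
      ∀ p ∈ upRays A, p.1 = x → ∃ t, t - p.2 ∈ Y p.1 ∧
        ∀ q ∈ fullPattern A B F, t - q.2 ∈ Y q.1 → q = p := by
  obtain ⟨α, hα, hαmin⟩ :=
    Set.exists_min_image (fiberAt A x) id (fiberAt_finite hA x) (fiberAt_nonempty hx)
  obtain ⟨f₀, hf₀⟩ := hFne
  have hfx : f₀.1 ∈ xCoords F := ⟨f₀, hf₀, rfl⟩
  obtain ⟨β, hβ, hβmax⟩ :=
    Set.exists_max_image (fiberAt F f₀.1) id (fiberAt_finite hF _) (fiberAt_nonempty hfx)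
  simp only [id] at hαmin hβmax
  have hne : f₀.1 ≠ x := fun h => Set.disjoint_left.1 hFA hfx (h ▸ hx)
  -- The column of `F` is used only in positions entirely below α, where the ray starts.
  refine ⟨fun s => {y | s = x ∧ y = 0 ∨ s = f₀.1 ∧ y + β < α}, fun t => ?_, ?_⟩
  · by_cases ht : α ≤ t
    · exact ⟨(x, t), Or.inl (Or.inl ⟨(x, α), hα, rfl, ht⟩), Or.inl ⟨rfl, sub_self t⟩⟩
    · exact ⟨(f₀.1, β), Or.inr hβ, Or.inr ⟨rfl, by simp only; omega⟩⟩
  · rintro p ⟨a, ha, h1, h2⟩ rfl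
    have hαa : α ≤ a.2 := hαmin a.2 (show (p.1, a.2) ∈ A by rw [h1]; exact ha)
    refine ⟨p.2, Or.inl ⟨rfl, sub_self _⟩, ?_⟩
    rintro q hq (⟨h3, h4⟩ | ⟨h3, h4⟩)
    · exact Prod.ext h3 (by omega)
    · have hqF := mem_F_of_fullPattern hBA hFA hq (h3 ▸ hfx)
      have := hβmax q.2 (show (f₀.1, q.2) ∈ F by rw [← h3]; exact hqF)
      omega

/-- A point outside the columns of `F` can be made indispensable, the rest of the column being
filled from a column of `F`. -/
theorem exists_local_complement_point (hF : F.Finite) (hFne : F.Nonempty)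
    (hBA : xCoords B ⊆ xCoords A) (hFA : Disjoint (xCoords F) (xCoords A))
    (p : ℤ × ℤ) (hp : p ∈ B) :
    ∃ Y : ℤ → Set ℤ, (∀ t, ∃ q ∈ fullPattern A B F, t - q.2 ∈ Y q.1) ∧
      ∃ t, t - p.2 ∈ Y p.1 ∧ ∀ q ∈ fullPattern A B F, t - q.2 ∈ Y q.1 → q = p := by
  obtain ⟨f₀, hf₀⟩ := hFne
  have hfx : f₀.1 ∈ xCoords F := ⟨f₀, hf₀, rfl⟩
  obtain ⟨β, hβ, hβmax⟩ :=
    Set.exists_max_image (fiberAt F f₀.1) id (fiberAt_finite hF _) (fiberAt_nonempty hfx)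
  obtain ⟨γ, hγ, hγmin⟩ :=
    Set.exists_min_image (fiberAt F f₀.1) id (fiberAt_finite hF _) (fiberAt_nonempty hfx)
  simp only [id] at hγmin hβmax
  have hne : f₀.1 ≠ p.1 := fun h =>
    Set.disjoint_left.1 hFA hfx (h ▸ hBA (show p.1 ∈ xCoords B from ⟨p, hp, rfl⟩))
  -- All translates of the column of `F` missing height p.2 are allowed: its top point β reaches
  -- everything below p.2, its bottom point γ everything above.
  refine ⟨fun s => {y | s = p.1 ∧ y = 0 ∨ s = f₀.1 ∧ (f₀.1, p.2 - y) ∉ F}, fun t => ?_,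
    p.2, Or.inl ⟨rfl, sub_self _⟩, ?_⟩
  · rcases lt_trichotomy t p.2 with ht | ht | ht
    · refine ⟨(f₀.1, β), Or.inr hβ, Or.inr ⟨rfl, fun h => ?_⟩⟩
      have := hβmax _ h
      simp only at this
      omega
    · exact ⟨p, Or.inl (Or.inr hp), Or.inl ⟨rfl, by omega⟩⟩
    · refine ⟨(f₀.1, γ), Or.inr hγ, Or.inr ⟨rfl, fun h => ?_⟩⟩
      have := hγmin _ h
      simp only at this
      omega
  · rintro q hq (⟨h3, h4⟩ | ⟨h3, h4⟩)
    · exact Prod.ext h3 (by omega)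
    · have hqF := mem_F_of_fullPattern hBA hFA hq (h3 ▸ hfx)
      refine absurd ?_ h4
      rw [sub_sub_cancel, ← h3]
      exact hqF

/-- Near a column of `F`, all points of that column can be made indispensable. -/
theorem exists_local_complement_finite (hF : F.Finite)
    (hBA : xCoords B ⊆ xCoords A) (hFA : Disjoint (xCoords F) (xCoords A))
    (x : ℤ) (hx : x ∈ xCoords F) :
    ∃ Y : ℤ → Set ℤ, (∀ t, ∃ q ∈ fullPattern A B F, t - q.2 ∈ Y q.1) ∧
      ∀ p ∈ F, p.1 = x → ∃ t, t - p.2 ∈ Y p.1 ∧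
        ∀ q ∈ fullPattern A B F, t - q.2 ∈ Y q.1 → q = p := by
  obtain ⟨U, hU, hUmin⟩ := isMAC_of_finite _ (fiberAt_finite hF x) (fiberAt_nonempty hx)
  have hcov : ∀ t, ∃ y ∈ fiberAt F x, t - y ∈ U := by
    intro t
    have ht : t ∈ fiberAt F x + U := by
      rw [show fiberAt F x + U = Set.univ from hU]
      trivial
    obtain ⟨y, hy, w, hw, rfl⟩ := Set.mem_add.1 ht
    exact ⟨y, hy, by rwa [add_sub_cancel_left]⟩
  refine ⟨fun s => {y | s = x ∧ y ∈ U}, fun t => ?_, ?_⟩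
  · obtain ⟨y, hy, hyU⟩ := hcov t
    exact ⟨(x, y), Or.inr hy, rfl, hyU⟩
  · rintro p hp rfl
    have hpf : p.2 ∈ fiberAt F p.1 := hp
    -- A height left uncovered when p is deleted is one that only p covers.
    have hnot := hUmin (fiberAt F p.1 \ {p.2}) (Set.sdiff_singleton_ssubset.2 hpf)
    obtain ⟨t, ht⟩ := (Set.ne_univ_iff_exists_notMem _).1 hnot
    have huniq : ∀ y ∈ fiberAt F p.1, t - y ∈ U → y = p.2 := by
      intro y hy hyU
      by_contra hyp
      exact ht (Set.mem_add.2 ⟨y, ⟨hy, hyp⟩, t - y, hyU, by omega⟩)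
    obtain ⟨y, hy, hyU⟩ := hcov t
    refine ⟨t, ⟨rfl, huniq y hy hyU ▸ hyU⟩, ?_⟩
    rintro q hq ⟨h1, h2⟩
    have hqF := mem_F_of_fullPattern hBA hFA hq (h1 ▸ hx)
    exact Prod.ext h1 (huniq q.2 (show (p.1, q.2) ∈ F by rw [← h1]; exact hqF) h2)

end LocalComplements

/-- The projected pattern is a MAC as soon as `m` has room for one special residue class for each
column of `A`, each point of `B` and each column of `F`. -/
theorem isMAC_evPeriodicSet {A B F : Set (ℤ × ℤ)} (hA : A.Finite) (hB : B.Finite) (hF : F.Finite)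
    (hFne : F.Nonempty) (hBA : xCoords B ⊆ xCoords A)
    (hFA : Disjoint (xCoords F) (xCoords A)) (m n : ℕ)
    (hn : IsBlockLength (xCoords (fullPattern A B F)) n)
    (hm : (n + 1) * ((xCoords A).ncard + B.ncard + (xCoords F).ncard) ≤ m) :
    IsMAC (evPeriodicSet m (latticeProj m '' A) (latticeProj m '' B) (latticeProj m '' F)) := by
  rw [← latticeProj_image_fullPattern]
  have : Finite (xCoords A) := hA.image _
  have : Finite (xCoords F) := hF.image _
  have : Finite B := hB
  choose YA hYA hYA' using fun x : xCoords A =>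
    exists_local_complement_ray (B := B) hA hF hFne hBA hFA x.1 x.2
  choose YB hYB hYB' using fun p : B =>
    exists_local_complement_point hF hFne hBA hFA p.1 p.2
  choose YF hYF hYF' using fun x : xCoords F =>
    exists_local_complement_finite (A := A) (B := B) hF hBA hFA x.1 x.2
  refine isMAC_latticeProj_image_of_card (ι := (xCoords A ⊕ B) ⊕ xCoords F) m n _ hn ?_
    (Sum.elim (Sum.elim YA YB) YF) ?_ ?_
  · rwa [Nat.card_sum, Nat.card_sum, Nat.card_coe_set_eq, Nat.card_coe_set_eq,
      Nat.card_coe_set_eq]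
  · rintro ((i | i) | i)
    · exact hYA i
    · exact hYB i
    · exact hYF i
  · rintro p ((hp | hp) | hp)
    · have hx : p.1 ∈ xCoords A := xCoords_upRays A ▸ ⟨p, hp, rfl⟩
      exact ⟨Sum.inl (Sum.inl ⟨p.1, hx⟩), hYA' ⟨p.1, hx⟩ p hp rfl⟩
    · exact ⟨Sum.inl (Sum.inr ⟨p, hp⟩), hYB' ⟨p, hp⟩⟩
    · have hx : p.1 ∈ xCoords F := ⟨p, hp, rfl⟩
      exact ⟨Sum.inr ⟨p.1, hx⟩, hYF' ⟨p.1, hx⟩ p hp rfl⟩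

/-! ### Block lengths and the explicit bound -/

/-- A block formed by translates of `S` is at least as long as `S`. -/
theorem IsBlockLength.sub_lt {S : Set ℤ} {n : ℕ} (h : IsBlockLength S n) {s t : ℤ} (hs : s ∈ S)
    (ht : t ∈ S) : t - s < n := by
  obtain ⟨a, b, W, hab, hW, hn⟩ := h
  have ha : a ∈ S + W := by rw [hW]; exact ⟨le_rfl, hab⟩
  obtain ⟨_, _, w, hw, _⟩ := Set.mem_add.1 ha
  have h1 : s + w ∈ S + W := Set.add_mem_add hs hw
  have h2 : t + w ∈ S + W := Set.add_mem_add ht hw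
  rw [hW] at h1 h2
  have := h1.1
  have := h2.2
  omega

/-- Points with equal image have `x`-coordinates differing by a multiple of m, hence by 0. This lets
the cardinalities of the projections replace those of the patterns. -/
theorem latticeProj_injOn (m : ℕ) (S : Set (ℤ × ℤ))
    (hS : ∀ p ∈ S, ∀ q ∈ S, q.1 - p.1 < m) : Set.InjOn (latticeProj m) S := by
  intro p hp q hq h
  simp only [latticeProj] at h
  have h1 := hS p hp q hq
  have h2 := hS q hq p hp
  have hm : (0 : ℤ) < m := by omega
  have hdvd : (m : ℤ) ∣ q.1 - p.1 := ⟨p.2 - q.2, by linarith⟩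
  have h0 : q.1 - p.1 = 0 := Int.eq_zero_of_abs_lt_dvd hdvd (by rw [abs_lt]; constructor <;> omega)
  refine Prod.ext (by omega) ?_
  have h3 : (m : ℤ) * p.2 = m * q.2 := by linarith
  exact mul_left_cancel₀ hm.ne' h3

/-- Translates of a finite set by an initial segment bridge everything from the end of the first
block to the beginning of the last one. -/
theorem minBlockLength_le_of_not_ordConnected (S : Set ℤ) (hS : S.Finite) (hne : S.Nonempty)
    (hc : ¬ S.OrdConnected) : (minBlockLength S : ℤ) ≤ outerrange S + innerrange S := by
  have hl := (isLeast_minBlockLength S hS hne).2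
  have hL : ∀ s ∈ S, sInf S ≤ s := fun s hs => csInf_le hS.bddBelow hs
  have hR : ∀ s ∈ S, s ≤ sSup S := fun s hs => le_csSup hS.bddAbove hs
  have hLm : sInf S ∈ S := Int.csInf_mem hne hS.bddBelow
  have hRm : sSup S ∈ S := Int.csSup_mem hne hS.bddAbove
  have hP : {s | s ∈ S ∧ s + 1 ∉ S}.Finite := hS.subset fun _ h => h.1
  have hQ : {s | s ∈ S ∧ s - 1 ∉ S}.Finite := hS.subset fun _ h => h.1
  have hPm := Int.csInf_mem (s := {s | s ∈ S ∧ s + 1 ∉ S})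
    ⟨sSup S, hRm, fun h => by have := hR _ h; omega⟩ hP.bddBelow
  have hQm := Int.csSup_mem (s := {s | s ∈ S ∧ s - 1 ∉ S})
    ⟨sInf S, hLm, fun h => by have := hL _ h; omega⟩ hQ.bddAbove
  have hPle : ∀ s ∈ S, s + 1 ∉ S → sInf {s | s ∈ S ∧ s + 1 ∉ S} ≤ s :=
    fun s h1 h2 => csInf_le hP.bddBelow ⟨h1, h2⟩
  have hQle : ∀ s ∈ S, s - 1 ∉ S → s ≤ sSup {s | s ∈ S ∧ s - 1 ∉ S} :=
    fun s h1 h2 => le_csSup hQ.bddAbove ⟨h1, h2⟩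
  unfold outerrange innerrange
  generalize sInf {s | s ∈ S ∧ s + 1 ∉ S} = p at *
  generalize sSup {s | s ∈ S ∧ s - 1 ∉ S} = q at *
  generalize sInf S = u at *
  generalize sSup S = v at *
  have hfirst : ∀ x, u ≤ x → x ≤ p → x ∈ S := by
    intro x hx
    induction x, hx using Int.leInduction with
    | base => exact fun _ => hLm
    | succ x hx ih =>
      intro h
      by_contra hn
      have := hPle x (ih (by omega)) hn
      omega
  have hlast : ∀ x, x ≤ v → q ≤ x → x ∈ S := by
    intro x hx
    induction x, hx using Int.leInductionDown with
    | base => exact fun _ => hRm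
    | pred x hx ih =>
      intro h
      by_contra hn
      have := hQle x (ih (by omega)) hn
      omega
  -- Otherwise the first and last runs together would fill [u, v].
  have hpq : p < q := by
    by_contra hqp
    refine hc ⟨fun x hx y hy z hz => ?_⟩
    by_cases hzp : z ≤ p
    · exact hfirst z (by have := hL x hx; have := hz.1; omega) hzp
    · exact hlast z (by have := hR y hy; have := hz.2; omega) (by omega)
  have hup := hL p hPm.1
  have hqv := hR q hQm.1
  -- Offsets up to q - p - 1 suffice: they carry p to q - 1, and q already starts the last run.
  have hblock : IsBlockLength S (v - u + (q - p)).toNat := by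
    refine ⟨u, v + (q - p) - 1, Set.Icc 0 (q - p - 1), by omega, ?_, by omega⟩
    ext z
    simp only [Set.mem_add, Set.mem_Icc]
    constructor
    · rintro ⟨s, hs, w, hw, rfl⟩
      have := hL s hs
      have := hR s hs
      omega
    · intro hz
      by_cases h1 : z ≤ p
      · exact ⟨z, hfirst z hz.1 h1, 0, by omega, by omega⟩
      by_cases h2 : z < q
      · exact ⟨p, hPm.1, z - p, by omega, by omega⟩
      by_cases h3 : z ≤ v
      · exact ⟨z, hlast z h3 (by omega), 0, by omega, by omega⟩
      · exact ⟨v, hRm, z - v, by omega, by omega⟩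
  have := hl hblock
  omega

/-- An interval is a block by itself, and no block is shorter than the span of S. -/
theorem minBlockLength_eq_of_ordConnected (S : Set ℤ) (hS : S.Finite) (hne : S.Nonempty)
    (hc : S.OrdConnected) : (minBlockLength S : ℤ) = outerrange S + 1 := by
  have hl := isLeast_minBlockLength S hS hne
  have hLm : sInf S ∈ S := Int.csInf_mem hne hS.bddBelow
  have hRm : sSup S ∈ S := Int.csSup_mem hne hS.bddAbove
  have hle : sInf S ≤ sSup S := csInf_le hS.bddBelow hRm
  have hIcc : S = Set.Icc (sInf S) (sSup S) :=
    Set.Subset.antisymm (fun s hs => ⟨csInf_le hS.bddBelow hs, le_csSup hS.bddAbove hs⟩)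
      (hc.out hLm hRm)
  have h1 := hl.1.sub_lt hLm hRm
  have h2 := hl.2 (show IsBlockLength S (sSup S - sInf S + 1).toNat from
    ⟨sInf S, sSup S, {0}, hle, by rw [Set.singleton_zero, add_zero]; exact hIcc, by omega⟩)
  unfold outerrange
  omega

theorem theorem6 (A B F : Set (ℤ × ℤ)) (hA : A.Finite) (hB : B.Finite) (hF : F.Finite)
    (hFne : F.Nonempty) (hBA : xCoords B ⊆ xCoords A)
    (hFA : Disjoint (xCoords F) (xCoords A)) :
    (∀ᶠ m : ℕ in Filter.atTop,
      IsMAC (evPeriodicSet m (latticeProj m '' A) (latticeProj m '' B) (latticeProj m '' F))) ∧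
    (∀ m : ℕ,
      (minBlockLength (xCoords (fullPattern A B F)) + 1) *
          ((latticeProj m '' A).ncard + (latticeProj m '' B).ncard + (xCoords F).ncard) ≤ m →
      IsMAC (evPeriodicSet m (latticeProj m '' A) (latticeProj m '' B) (latticeProj m '' F))) ∧
    (¬ (xCoords (fullPattern A B F)).OrdConnected →
      (minBlockLength (xCoords (fullPattern A B F)) : ℤ) ≤
        outerrange (xCoords (fullPattern A B F)) + innerrange (xCoords (fullPattern A B F))) ∧
    ((xCoords (fullPattern A B F)).OrdConnected →
      (minBlockLength (xCoords (fullPattern A B F)) : ℤ) =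
        outerrange (xCoords (fullPattern A B F)) + 1) := by
  have hfin : (xCoords (fullPattern A B F)).Finite := by
    rw [xCoords_fullPattern]
    exact ((hA.image _).union (hB.image _)).union (hF.image _)
  have hne : (xCoords (fullPattern A B F)).Nonempty := by
    rw [xCoords_fullPattern]
    exact (hFne.image _).inr
  have hl := (isLeast_minBlockLength _ hfin hne).1
  have hAle : (xCoords A).ncard ≤ A.ncard := Set.ncard_image_le hA
  refine ⟨?_, fun m hm => ?_, minBlockLength_le_of_not_ordConnected _ hfin hne,
    minBlockLength_eq_of_ordConnected _ hfin hne⟩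
  -- This threshold counts pattern points and columns rather than projected points, so it does not
  -- depend on m.
  · filter_upwards [Filter.eventually_ge_atTop
      ((minBlockLength (xCoords (fullPattern A B F)) + 1) *
        ((xCoords A).ncard + B.ncard + (xCoords F).ncard))] with m hm
    exact isMAC_evPeriodicSet hA hB hF hFne hBA hFA m _ hl hm
  · have hpos : 1 ≤ (xCoords F).ncard :=
      (Set.ncard_pos (hF.image _)).2 (hFne.image _)
    -- Since `F` has at least one column, the bound forces m > ℓ, which exceeds the width of the
    -- pattern.
    have hlm : minBlockLength (xCoords (fullPattern A B F)) < m :=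
      lt_of_lt_of_le (Nat.lt_succ_self _)
        (le_trans (Nat.le_mul_of_pos_right _ (by omega)) hm)
    have hinj : ∀ S : Set (ℤ × ℤ), xCoords S ⊆ xCoords (fullPattern A B F) →
        (latticeProj m '' S).ncard = S.ncard := fun S hS =>
      Set.InjOn.ncard_image <| latticeProj_injOn m S fun p hp q hq =>
        (hl.sub_lt (hS ⟨p, hp, rfl⟩) (hS ⟨q, hq, rfl⟩)).trans (by exact_mod_cast hlm)
    rw [hinj A (by rw [xCoords_fullPattern]; exact fun x hx => Or.inl (Or.inl hx)),
      hinj B (by rw [xCoords_fullPattern]; exact fun x hx => Or.inl (Or.inr hx))] at hm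
    exact isMAC_evPeriodicSet hA hB hF hFne hBA hFA m _ hl
      (le_trans (Nat.mul_le_mul_left _ (by omega)) hm)
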